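/- Let $m\ge 3$, $0\le\nu\le m$, $p=m-2$, and let $\mathbb R^m_\nu$ be $\mathbb R^m$ with the metric $\bar g_{ij}=\delta_{ij}\bar g_j$, where $\bar g_1=\dots=\bar g_\nu=-1$ and $\bar g_{\nu+1}=\dots=\bar g_m=1$. Let $\Sigma$ be a smooth $2$-dimensional manifold, smoothly embedded in $\mathbb R^m_\nu$ by $x=(x^1,\dots,x^m)$, such that the induced metric on $\Sigma$ is nondegenerate. Let $\omega$ be a symplectic form on $\Sigma$ (so $\Sigma$ is orientable). For $f,h\in C^\infty(\Sigma)$ let $X_f$ be the vector field with $\omega(X_f,Y)=df(Y)$ for all vector fields $Y$ on $\Sigma$, and let $\{f,h\}=\omega(X_f,X_h)$ be the Poisson bracket. Let $(u^1,u^2)$ be any smooth local coordinates on $\Sigma$. Write $\omega=\rho\,du^1\wedge du^2$, $e_a=(\partial_a x^i)\partial_i$, $g_{ab}=\bar g(e_a,e_b)$ and $g=\det(g_{ab})$, and let $(g^{ab})$ be the inverse matrix of $(g_{ab})$. Let $R_{XY}Z=\nabla_{[X,Y]}Z-[\nabla_X,\nabla_Y]Z$ be the curvature tensor of the Levi-Civita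 connection $\nabla$ of the induced metric. Let $K=\frac1g\,\bar g(R_{e_1e_2}e_1,e_2)$ be the Gauss curvature and $H=\frac12 g^{ab}\,\mathrm{II}(e_a,e_b)$ the mean curvature vector, where $\mathrm{II}(e_a,e_b)$ is the component of $\partial_a\partial_b x$ normal to $\Sigma$. Then on the whole coordinate domain $$K=-\frac{\rho^4}{8g^2(p-1)!}\sum_{L}\sum_{i,j,k,l,r,n}\bar g_i\bar g_r\bar g_n\,\varepsilon_{jklL}\,\varepsilon_{irnL}\,\{x^i,\{x^k,x^l\}\}\{x^j,\{x^r,x^n\}\},$$ $$H=\frac{\rho^4}{8g^2(p-1)!}\sum_{L,k'}\sum_{i,j,k,l,r,n}\bar g_j\bar g_k\bar g_l\,\varepsilon_{irnL}\,\varepsilon_{k'klL}\,\{x^i,x^j\}\{x^j,\{x^r,x^n\}\}\{x^k,x^l\}\,\partial_{k'},$$ where $L$ runs over $\{1,\dots,m\}^{p-1}$, the other indices run over $\{1,\dots,m\}$, and $\varepsilon$ is the Levi-Civita symbol. -/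

import Mathlib

open scoped Manifold ContDiff Nat

noncomputable section

namespace PseudoSurface

/-! ### The ambient space `ℝ^m_ν` -/

/-- The diagonal entries of the metric of `ℝ^m_ν`: the first `ν` are `-1`, the others `1`. -/
def gbar {m : ℕ} (ν : ℕ) (i : Fin m) : ℝ := if (i : ℕ) < ν then -1 else 1

/-- The scalar product of `ℝ^m_ν`. -/
def scal {m : ℕ} (ν : ℕ) (v w : Fin m → ℝ) : ℝ := ∑ i, gbar ν i * v i * w i

/-- The multi-index `(j, k, l, L)` of length `m`, where `L` has length `m - 3`
(used for `3 ≤ m` only). -/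
def multiIndex {m : ℕ} (j k l : Fin m) (L : Fin (m - 3) → Fin m) : Fin m → Fin m :=
  fun s => if h : 3 ≤ (s : ℕ) then L ⟨(s : ℕ) - 3, by omega⟩ else ![j, k, l] ⟨(s : ℕ), by omega⟩

open Classical in
/-- The Levi-Civita symbol of a multi-index of length `m`: the sign of the permutation
`s ↦ I s` if this is one, and `0` otherwise. -/
def leviCivita {m : ℕ} (I : Fin m → Fin m) : ℝ :=
  if h : Function.Bijective I then ((Equiv.Perm.sign (Equiv.ofBijective I h) : ℤ) : ℝ) else 0

/-- `ε_{jklL}`. -/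
def eps {m : ℕ} (j k l : Fin m) (L : Fin (m - 3) → Fin m) : ℝ := leviCivita (multiIndex j k l L)

/-! ### Coordinates on a surface -/

variable {S : Type*} [TopologicalSpace S] [ChartedSpace (EuclideanSpace ℝ (Fin 2)) S]

/-- The partial derivative `∂_a f` of a function on the surface, in the coordinates given by the
chart `u`. -/
def pd (u : OpenPartialHomeomorph S (EuclideanSpace ℝ (Fin 2))) (a : Fin 2) (f : S → ℝ) : S → ℝ :=
  fun p => fderiv ℝ (f ∘ u.symm) (u p) (EuclideanSpace.single a 1)

/-- The coordinate vector `∂_a` at `p` of the chart `u`, i.e. the tangent vector that the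
differential of `u` sends to the `a`-th standard basis vector. -/
def coordVec (u : OpenPartialHomeomorph S (EuclideanSpace ℝ (Fin 2))) (a : Fin 2) (p : S) :
    TangentSpace (𝓡 2) p :=
  (mfderiv (𝓡 2) (𝓡 2) u p).inverse
    (EuclideanSpace.single a (1 : ℝ) : EuclideanSpace ℝ (Fin 2))

/-! ### Symplectic forms and Poisson brackets on a surface -/

variable (S) in
/-- A symplectic form on a surface: a smooth nondegenerate 2-form (closedness is automatic in
dimension two). Smoothness is smoothness of the coefficient `Ω(∂₁, ∂₂)` in every smooth chart. -/
structure SymplecticForm where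
  /-- the bilinear form at each point -/
  toFun : ∀ p : S, TangentSpace (𝓡 2) p →L[ℝ] TangentSpace (𝓡 2) p →L[ℝ] ℝ
  alt : ∀ (p : S) (v : TangentSpace (𝓡 2) p), toFun p v v = 0
  nondegenerate : ∀ (p : S) (v : TangentSpace (𝓡 2) p), (∀ w, toFun p v w = 0) → v = 0
  smooth : ∀ u ∈ IsManifold.maximalAtlas (𝓡 2) ∞ S,
    ContMDiffOn (𝓡 2) 𝓘(ℝ, ℝ) ∞ (fun p => toFun p (coordVec u 0 p) (coordVec u 1 p)) u.source

/-- The function `ρ` with `Ω = ρ du¹ ∧ du²` in the chart `u`. -/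
def SymplecticForm.rho (Ω : SymplecticForm S)
    (u : OpenPartialHomeomorph S (EuclideanSpace ℝ (Fin 2))) : S → ℝ :=
  fun p => Ω.toFun p (coordVec u 0 p) (coordVec u 1 p)

theorem SymplecticForm.exists_hamiltonian (Ω : SymplecticForm S) (p : S)
    (α : TangentSpace (𝓡 2) p →L[ℝ] ℝ) :
    ∃ v : TangentSpace (𝓡 2) p, ∀ w, Ω.toFun p v w = α w := by
  let V := EuclideanSpace ℝ (Fin 2)
  let B : V →L[ℝ] V →L[ℝ] ℝ := Ω.toFun p
  let T : V →ₗ[ℝ] Module.Dual ℝ V :=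
    { toFun := fun v => (B v : V →ₗ[ℝ] ℝ)
      map_add' := fun v w => by ext; simp
      map_smul' := fun c v => by ext; simp }
  have hinj : Function.Injective T := by
    rw [injective_iff_map_eq_zero]
    intro v hv
    exact Ω.nondegenerate p v fun w => LinearMap.congr_fun hv w
  have hsurj : Function.Surjective T :=
    (LinearMap.injective_iff_surjective_of_finrank_eq_finrank
      (Subspace.dual_finrank_eq (K := ℝ) (V := V)).symm).1 hinj
  let α' : V →L[ℝ] ℝ := α
  obtain ⟨v, hv⟩ := hsurj (α' : V →ₗ[ℝ] ℝ)
  exact ⟨v, fun w => LinearMap.congr_fun hv w⟩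

/-- The Hamiltonian vector field `X_f`, the unique one with `Ω(X_f, Y) = df(Y)` for all `Y`. -/
def SymplecticForm.hamiltonian (Ω : SymplecticForm S) (f : S → ℝ) (p : S) :
    TangentSpace (𝓡 2) p :=
  (Ω.exists_hamiltonian p (mfderiv (𝓡 2) 𝓘(ℝ, ℝ) f p)).choose

theorem SymplecticForm.hamiltonian_spec (Ω : SymplecticForm S) (f : S → ℝ) (p : S)
    (w : TangentSpace (𝓡 2) p) :
    Ω.toFun p (Ω.hamiltonian f p) w = mfderiv (𝓡 2) 𝓘(ℝ, ℝ) f p w :=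
  (Ω.exists_hamiltonian p (mfderiv (𝓡 2) 𝓘(ℝ, ℝ) f p)).choose_spec w

/-- The Poisson bracket `{f, h} = Ω(X_f, X_h)`. -/
def SymplecticForm.bracket (Ω : SymplecticForm S) (f h : S → ℝ) : S → ℝ :=
  fun p => Ω.toFun p (Ω.hamiltonian f p) (Ω.hamiltonian h p)

/-! ### The geometry of a surface in `ℝ^m_ν` -/

variable {m : ℕ}

/-- The pull-back to the surface of the metric of `ℝ^m_ν` is nondegenerate at every point. -/
def IsPseudoRiemannian (ν : ℕ) (x : S → Fin m → ℝ) : Prop :=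
  ∀ (p : S) (v : TangentSpace (𝓡 2) p),
    (∀ w : TangentSpace (𝓡 2) p, scal ν (mfderiv (𝓡 2) 𝓘(ℝ, Fin m → ℝ) x p v)
      (mfderiv (𝓡 2) 𝓘(ℝ, Fin m → ℝ) x p w) = 0) → v = 0

variable (ν : ℕ) (x : S → Fin m → ℝ) (u : OpenPartialHomeomorph S (EuclideanSpace ℝ (Fin 2)))

/-- `e_a = (∂_a x^i) ∂_i`. -/
def frame (a : Fin 2) (p : S) : Fin m → ℝ := fun i => pd u a (fun q => x q i) p

/-- The induced metric `g_{ab}` in the chart `u`. -/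
def metric (p : S) : Matrix (Fin 2) (Fin 2) ℝ :=
  Matrix.of fun a b => scal ν (frame x u a p) (frame x u b p)

/-- `g = det (g_{ab})`. -/
def gdet (p : S) : ℝ := (metric ν x u p).det

/-- The Christoffel symbols `Γ^c_{ab}` of the Levi-Civita connection of the induced metric. -/
def christoffel (c a b : Fin 2) (p : S) : ℝ :=
  (1 / 2) * ∑ d, (metric ν x u p)⁻¹ c d *
    (pd u a (fun q => metric ν x u q b d) p + pd u b (fun q => metric ν x u q a d) p
      - pd u d (fun q => metric ν x u q a b) p)

/-- The `d`-th component of `R(e_a, e_b) e_c`, where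
`R(X, Y) Z = ∇_{[X,Y]} Z - ∇_X ∇_Y Z + ∇_Y ∇_X Z`. -/
def riemann (a b c d : Fin 2) (p : S) : ℝ :=
  pd u b (christoffel ν x u d a c) p - pd u a (christoffel ν x u d b c) p
    + ∑ f, (christoffel ν x u f a c p * christoffel ν x u d b f p
      - christoffel ν x u f b c p * christoffel ν x u d a f p)

/-- The (intrinsic) Gauss curvature `K = g(R(e₁, e₂) e₁, e₂) / det (g_{ab})` of the induced
metric. -/
def gaussCurvature (p : S) : ℝ :=
  (∑ d, riemann ν x u 0 1 0 d p * metric ν x u p d 1) / gdet ν x u p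

/-- The orthogonal projection `g^{cd} ⟨v, e_c⟩ e_d` of `v` to the tangent space at `p`. -/
def tanProj (p : S) (v : Fin m → ℝ) : Fin m → ℝ :=
  ∑ c, ∑ d, ((metric ν x u p)⁻¹ c d * scal ν v (frame x u c p)) • frame x u d p

/-- The shape tensor `II(e_a, e_b)`, the normal part of the ambient covariant derivative of `e_b`
along `e_a`. In the flat space `ℝ^m_ν` the latter is the componentwise derivative. -/
def shape (a b : Fin 2) (p : S) : Fin m → ℝ :=
  let D : Fin m → ℝ := fun i => pd u a (fun q => frame x u b q i) p
  D - tanProj ν x u p D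

/-- The mean curvature vector `H = (1/2) g^{ab} II(e_a, e_b)`. -/
def meanCurvature (p : S) : Fin m → ℝ :=
  (1 / 2 : ℝ) • ∑ a, ∑ b, (metric ν x u p)⁻¹ a b • shape ν x u a b p

end PseudoSurface

end

/-!
In the chart `u` the Poisson bracket is `{f, h} = ρ⁻¹ (∂₁f ∂₂h - ∂₂f ∂₁h)`
(`SymplecticForm.bracket_eq`). So `{x^k, x^l}` is the bivector `b = ρ⁻¹ e₁ ∧ e₂`, and
`{x^i, {x^k, x^l}}` is `ρ⁻¹ (e₁^i ∂₂b^{kl} - e₂^i ∂₁b^{kl})`. In both sums the Levi-Civita symbols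
antisymmetrize a vector `e_c` with a bivector `∂_a b`. The terms of `∂_a b` that contain `e_c`, in
particular the one with the derivative of `ρ⁻¹`, disappear, and
`e_c ∧ ∂_a b = -ρ⁻¹ e₁ ∧ e₂ ∧ ∂_a∂_c x` remains (`dualWedge_fst_bivectorDeriv`,
`dualWedge_snd_bivectorDeriv`; `dualWedge` and `dualTriple` are the contractions with `ε`).

For fixed `L` each sixfold sum is therefore a combination of products of two such trivectors
(`sum_curvature_factor`, `sum_meanCurvature_factor`). Summing over `L` contracts two Levi-Civita
symbols to a generalized Kronecker delta (`sum_leviCivita_tripleIndex_mul`), which turns the product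
of the trivectors into a `3 × 3` Gram determinant (`sum_dualTriple_mul`). The Gram determinant of
`(e₁, e₂, D)` against `(e₁, e₂, D')` is `g` times the scalar product of the normal parts of `D` and
`D'`; against `(e₁, e₂, ∂_{k'})` it is `g` times the `k'`-th component of the normal part of `D`.

The second identity follows at once. The first one becomes the Gauss equation
`g K = ⟨II₁₁, II₂₂⟩ - ⟨II₁₂, II₁₂⟩` (`gdet_mul_gaussCurvature`), where `K` is defined by the
Christoffel symbols. It is proved by differentiating `Γ^c_{ab} g_{cd} = ⟨∂_a∂_b x, e_d⟩`, with third
derivatives of `x` cancelling by symmetry. (Coordinates are numbered `1, 2` in these comments and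
`0, 1` in `Fin 2`.) That `ρ` and `g` do not vanish comes from the nondegeneracy of the symplectic
form and of the induced metric.
-/

noncomputable section

namespace PseudoSurface

/-! ### The Levi-Civita symbol -/

theorem leviCivita_eq_zero {m : ℕ} {I : Fin m → Fin m} (h : ¬ Function.Injective I) :
    leviCivita I = 0 :=
  dif_neg fun hb => h hb.injective

theorem leviCivita_comp_perm {m : ℕ} (I : Fin m → Fin m) (σ : Equiv.Perm (Fin m)) :
    leviCivita (I ∘ σ) = ((Equiv.Perm.sign σ : ℤ) : ℝ) * leviCivita I := by
  unfold leviCivita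
  by_cases h : Function.Bijective I
  · have h' : Function.Bijective (I ∘ σ) := h.comp σ.bijective
    rw [dif_pos h, dif_pos h']
    have : Equiv.ofBijective (I ∘ σ) h' = Equiv.ofBijective I h * σ := by
      ext s; rfl
    rw [this, Equiv.Perm.sign_mul]
    push_cast
    ring
  · have h' : ¬ Function.Bijective (I ∘ σ) := fun hb => h <| by
      have := hb.comp σ.symm.bijective
      simpa [Function.comp_assoc] using this
    rw [dif_neg h, dif_neg h', mul_zero]

open Classical in
theorem leviCivita_mul_self {m : ℕ} (I : Fin m → Fin m) :
    leviCivita I * leviCivita I = if Function.Injective I then 1 else 0 := by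
  by_cases h : Function.Injective I
  · have hb : Function.Bijective I := Finite.injective_iff_bijective.1 h
    rw [if_pos h, leviCivita, dif_pos hb]
    rcases Int.units_eq_one_or (Equiv.Perm.sign (Equiv.ofBijective I hb)) with h1 | h1 <;>
      simp [h1]
  · rw [if_neg h, leviCivita_eq_zero h, mul_zero]

/-- `multiIndex` with the three leading indices packed into a function. -/
def tripleIndex {m : ℕ} (J : Fin 3 → Fin m) (L : Fin (m - 3) → Fin m) : Fin m → Fin m :=
  fun s => if h : 3 ≤ (s : ℕ) then L ⟨(s : ℕ) - 3, by omega⟩ else J ⟨(s : ℕ), by omega⟩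

theorem eps_eq_leviCivita {m : ℕ} (j k l : Fin m) (L : Fin (m - 3) → Fin m) :
    eps j k l L = leviCivita (tripleIndex ![j, k, l] L) := rfl

/-- The positions of a multi-index of length `m ≥ 3` occupied by the three leading indices. -/
def leadingEquiv {m : ℕ} (hm : 3 ≤ m) : Fin 3 ≃ {s : Fin m // (s : ℕ) < 3} where
  toFun a := ⟨⟨a, by omega⟩, a.2⟩
  invFun s := ⟨s.1, s.2⟩
  left_inv _ := rfl
  right_inv _ := rfl

theorem leviCivita_tripleIndex_comp_perm {m : ℕ} (hm : 3 ≤ m) (J : Fin 3 → Fin m)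
    (L : Fin (m - 3) → Fin m) (τ : Equiv.Perm (Fin 3)) :
    leviCivita (tripleIndex (J ∘ τ) L)
      = ((Equiv.Perm.sign τ : ℤ) : ℝ) * leviCivita (tripleIndex J L) := by
  have h : tripleIndex (J ∘ τ) L = tripleIndex J L ∘ τ.extendDomain (leadingEquiv hm) := by
    funext s
    by_cases hs : (s : ℕ) < 3
    · obtain ⟨a, rfl⟩ : ∃ a, s = (leadingEquiv hm a : Fin m) := ⟨⟨s, hs⟩, rfl⟩
      rw [Function.comp_apply, Equiv.Perm.extendDomain_apply_image]
      simp [tripleIndex, leadingEquiv, not_le.2 a.2, not_le.2 (τ a).2]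
    · rw [Function.comp_apply, τ.extendDomain_apply_not_subtype (leadingEquiv hm) hs]
      simp [tripleIndex, not_lt.1 hs]
  rw [h, leviCivita_comp_perm, Equiv.Perm.sign_extendDomain]

theorem tripleIndex_injective_iff {m : ℕ} (hm : 3 ≤ m) (J : Fin 3 → Fin m)
    (L : Fin (m - 3) → Fin m) :
    Function.Injective (tripleIndex J L) ↔
      Function.Injective J ∧ Function.Injective L ∧ ∀ a b, L a ≠ J b := by
  have hJ : ∀ a : Fin 3, tripleIndex J L ⟨a, by omega⟩ = J a := fun a => by
    simp [tripleIndex, a.2]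
  have hL : ∀ a : Fin (m - 3), tripleIndex J L ⟨a + 3, by omega⟩ = L a := fun a => by
    simp [tripleIndex]
  constructor
  · intro h
    refine ⟨fun a b hab => ?_, fun a b hab => ?_, fun a b hab => ?_⟩
    · rw [← hJ, ← hJ] at hab
      have := h hab
      simp only [Fin.mk.injEq] at this
      omega
    · rw [← hL, ← hL] at hab
      have := h hab
      simp only [Fin.mk.injEq] at this
      omega
    · rw [← hL, ← hJ] at hab
      have := h hab
      simp only [Fin.mk.injEq] at this
      omega
  · rintro ⟨h1, h2, h3⟩ s t hst
    unfold tripleIndex at hst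
    split_ifs at hst with ha hb hb
    · have := h2 hst
      simp only [Fin.mk.injEq] at this
      omega
    · exact absurd hst (h3 _ _)
    · exact absurd hst.symm (h3 _ _)
    · have := h1 hst
      simp only [Fin.mk.injEq] at this
      omega

/-- Three distinct indices extend to a permutation of all `m` indices in `(m - 3)!` ways. -/
theorem sum_leviCivita_tripleIndex_mul_self {m : ℕ} (hm : 3 ≤ m) {J : Fin 3 → Fin m}
    (hJ : Function.Injective J) :
    ∑ L, leviCivita (tripleIndex J L) * leviCivita (tripleIndex J L) = ((m - 3)! : ℝ) := by
  classical
  simp only [leviCivita_mul_self]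
  rw [Finset.sum_boole]
  norm_cast
  rw [← Fintype.card_subtype]
  let e : {L : Fin (m - 3) → Fin m // Function.Injective (tripleIndex J L)} ≃
      (Fin (m - 3) ↪ {t : Fin m // t ∉ Set.range J}) :=
    { toFun := fun L =>
        ⟨fun a => ⟨L.1 a, fun ⟨b, hb⟩ =>
            ((tripleIndex_injective_iff hm J L.1).1 L.2).2.2 a b hb.symm⟩,
          fun a b hab => ((tripleIndex_injective_iff hm J L.1).1 L.2).2.1
            (congrArg Subtype.val hab)⟩
      invFun := fun f => ⟨fun a => (f a).1, (tripleIndex_injective_iff hm J _).2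
        ⟨hJ, fun a b hab => f.injective (Subtype.ext hab), fun a b hab => (f a).2 ⟨b, hab.symm⟩⟩⟩
      left_inv := fun _ => rfl
      right_inv := fun _ => rfl }
  rw [Fintype.card_congr e, Fintype.card_embedding_eq, Fintype.card_fin,
    Fintype.card_subtype_compl, Fintype.card_fin]
  have : Fintype.card {t : Fin m // t ∈ Set.range J} = 3 := by
    rw [← Fintype.card_congr (Equiv.ofInjective J hJ), Fintype.card_fin]
  rw [this, Nat.descFactorial_self]

/-- The contraction of two Levi-Civita symbols over all but three indices is a generalized
Kronecker delta. -/
theorem sum_leviCivita_tripleIndex_mul {m : ℕ} (hm : 3 ≤ m) (J I : Fin 3 → Fin m) :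
    ∑ L, leviCivita (tripleIndex J L) * leviCivita (tripleIndex I L)
      = ((m - 3)! : ℝ) * (Matrix.of fun a b => if J a = I b then (1 : ℝ) else 0).det := by
  by_cases hJ : Function.Injective J
  swap
  · have hJ' := hJ
    simp only [Function.Injective, not_forall] at hJ'
    obtain ⟨a, b, hab, hne⟩ := hJ'
    rw [Matrix.det_zero_of_row_eq hne (by ext c; simp [hab]), mul_zero]
    refine Finset.sum_eq_zero fun L _ => ?_
    rw [leviCivita_eq_zero fun h => hJ ((tripleIndex_injective_iff hm J L).1 h).1, zero_mul]
  by_cases hI : ∀ b, ∃ a, J a = I b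
  · choose τ hτ using hI
    obtain rfl : J ∘ τ = I := funext hτ
    by_cases hinj : Function.Injective τ
    · obtain ⟨σ, rfl⟩ : ∃ σ : Equiv.Perm (Fin 3), τ = σ :=
        ⟨Equiv.ofBijective τ (Finite.injective_iff_bijective.1 hinj), rfl⟩
      have hM : (Matrix.of fun a b => if J a = (J ∘ σ) b then (1 : ℝ) else 0)
          = (1 : Matrix (Fin 3) (Fin 3) ℝ).submatrix id σ := by
        ext a b
        simp [Matrix.one_apply, hJ.eq_iff]
      rw [hM, Matrix.det_permute', Matrix.det_one, mul_one,
        ← sum_leviCivita_tripleIndex_mul_self hm hJ, Finset.sum_mul]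
      refine Finset.sum_congr rfl fun L _ => ?_
      rw [leviCivita_tripleIndex_comp_perm hm]
      ring
    · have h' := hinj
      simp only [Function.Injective, not_forall] at h'
      obtain ⟨a, b, hab, hne⟩ := h'
      rw [Matrix.det_zero_of_column_eq hne (by intro c; simp [hab]), mul_zero]
      refine Finset.sum_eq_zero fun L _ => ?_
      have : ¬ Function.Injective (tripleIndex (J ∘ τ) L) := fun h =>
        hinj (((tripleIndex_injective_iff hm _ L).1 h).1.of_comp)
      rw [leviCivita_eq_zero this, mul_zero]
  · push Not at hI
    obtain ⟨b, hb⟩ := hI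
    rw [Matrix.det_eq_zero_of_column_eq_zero b (fun a => by simp [hb a]), mul_zero]
    refine Finset.sum_eq_zero fun L _ => ?_
    by_contra hne
    have h1 : Function.Injective (tripleIndex J L) := by
      by_contra h
      exact hne (by rw [leviCivita_eq_zero h, zero_mul])
    have h2 : Function.Injective (tripleIndex I L) := by
      by_contra h
      exact hne (by rw [leviCivita_eq_zero h, mul_zero])
    -- `tripleIndex J L` is onto, so `I b`, which is not among `J`, is among `L`.
    obtain ⟨s, hs⟩ := (Finite.injective_iff_surjective.1 h1) (I b)
    unfold tripleIndex at hs
    split_ifs at hs with h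
    · exact ((tripleIndex_injective_iff hm I L).1 h2).2.2 _ _ hs
    · exact hb _ hs

/-! ### Trivectors -/

/-- The contraction `ε_{jklL} a^j M^{kl}`: the `L`-component of the Hodge dual of `a ∧ M`, without
normalization. -/
def dualWedge {m : ℕ} (L : Fin (m - 3) → Fin m) (a : Fin m → ℝ) (M : Fin m → Fin m → ℝ) : ℝ :=
  ∑ j, ∑ k, ∑ l, eps j k l L * a j * M k l

/-- The contraction `ε_{jklL} a^j b^k c^l`: the `L`-component of the Hodge dual of
`a ∧ b ∧ c`. -/
def dualTriple {m : ℕ} (L : Fin (m - 3) → Fin m) (a b c : Fin m → ℝ) : ℝ :=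
  dualWedge L a fun k l => b k * c l

section

variable {m : ℕ} (L : Fin (m - 3) → Fin m)

theorem eps_swap_left (hm : 3 ≤ m) (j k l : Fin m) : eps k j l L = -eps j k l L := by
  have h : (![k, j, l] : Fin 3 → Fin m) = ![j, k, l] ∘ Equiv.swap (0 : Fin 3) 1 := by
    funext a; fin_cases a <;> rfl
  rw [eps_eq_leviCivita, eps_eq_leviCivita, h, leviCivita_tripleIndex_comp_perm hm,
    Equiv.Perm.sign_swap (by decide)]
  simp

theorem eps_swap_right (hm : 3 ≤ m) (j k l : Fin m) : eps j l k L = -eps j k l L := by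
  have h : (![j, l, k] : Fin 3 → Fin m) = ![j, k, l] ∘ Equiv.swap (1 : Fin 3) 2 := by
    funext a; fin_cases a <;> rfl
  rw [eps_eq_leviCivita, eps_eq_leviCivita, h, leviCivita_tripleIndex_comp_perm hm,
    Equiv.Perm.sign_swap (by decide)]
  simp

theorem dualTriple_eq_sum (a b c : Fin m → ℝ) :
    dualTriple L a b c = ∑ j, ∑ k, ∑ l, eps j k l L * (a j * b k * c l) := by
  simp only [dualTriple, dualWedge]
  exact Finset.sum_congr rfl fun j _ => Finset.sum_congr rfl fun k _ =>
    Finset.sum_congr rfl fun l _ => by ring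

theorem dualTriple_swap_left (hm : 3 ≤ m) (a b c : Fin m → ℝ) :
    dualTriple L b a c = -dualTriple L a b c := by
  rw [dualTriple_eq_sum, dualTriple_eq_sum, Finset.sum_comm]
  simp only [← Finset.sum_neg_distrib]
  refine Finset.sum_congr rfl fun j _ => Finset.sum_congr rfl fun k _ =>
    Finset.sum_congr rfl fun l _ => ?_
  rw [eps_swap_left L hm]
  ring

theorem dualTriple_swap_right (hm : 3 ≤ m) (a b c : Fin m → ℝ) :
    dualTriple L a c b = -dualTriple L a b c := by
  rw [dualTriple_eq_sum, dualTriple_eq_sum]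
  simp only [← Finset.sum_neg_distrib]
  refine Finset.sum_congr rfl fun j _ => ?_
  rw [Finset.sum_comm]
  refine Finset.sum_congr rfl fun k _ => Finset.sum_congr rfl fun l _ => ?_
  rw [eps_swap_right L hm]
  ring

theorem dualTriple_self_left (hm : 3 ≤ m) (a c : Fin m → ℝ) : dualTriple L a a c = 0 := by
  linarith [dualTriple_swap_left L hm a a c]

theorem dualTriple_self_outer (hm : 3 ≤ m) (a c : Fin m → ℝ) : dualTriple L a c a = 0 := by
  rw [dualTriple_swap_right L hm, dualTriple_self_left L hm, neg_zero]

end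

open Matrix in
/-- The Gram determinant formula for the scalar product of two trivectors. -/
theorem sum_dualTriple_mul {m : ℕ} (hm : 3 ≤ m) (a b c a' b' c' : Fin m → ℝ) :
    ∑ L, dualTriple L a b c * dualTriple L a' b' c' = ((m - 3)! : ℝ) *
      !![a ⬝ᵥ a', a ⬝ᵥ b', a ⬝ᵥ c'; b ⬝ᵥ a', b ⬝ᵥ b', b ⬝ᵥ c';
        c ⬝ᵥ a', c ⬝ᵥ b', c ⬝ᵥ c'].det := by
  have h1 : ∀ L : Fin (m - 3) → Fin m, dualTriple L a b c * dualTriple L a' b' c'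
      = ∑ j, ∑ k, ∑ l, ∑ i, ∑ r, ∑ n, eps j k l L * eps i r n L *
          (a j * b k * c l * (a' i * b' r * c' n)) := by
    intro L
    rw [dualTriple_eq_sum, dualTriple_eq_sum]
    simp only [Finset.sum_mul]
    simp only [Finset.mul_sum]
    exact Finset.sum_congr rfl fun j _ => Finset.sum_congr rfl fun k _ =>
      Finset.sum_congr rfl fun l _ => Finset.sum_congr rfl fun i _ =>
      Finset.sum_congr rfl fun r _ => Finset.sum_congr rfl fun n _ => by ring
  have h2 : ∀ j k l : Fin m, ∑ i, ∑ r, ∑ n, (∑ L, eps j k l L * eps i r n L) *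
      (a j * b k * c l * (a' i * b' r * c' n)) = ((m - 3)! : ℝ) * (a j * b k * c l *
        !![a' j, b' j, c' j; a' k, b' k, c' k; a' l, b' l, c' l].det) := by
    intro j k l
    let d : Fin m → Fin m → ℝ := fun s t => if s = t then 1 else 0
    have hM : ∀ i r n : Fin m,
        (Matrix.of fun s t => if ![j, k, l] s = ![i, r, n] t then (1 : ℝ) else 0)
          = !![d j i, d j r, d j n; d k i, d k r, d k n; d l i, d l r, d l n] := by
      intro i r n
      ext s t
      fin_cases s <;> fin_cases t <;> rfl
    simp only [eps_eq_leviCivita, sum_leviCivita_tripleIndex_mul hm, hM, det_fin_three, of_apply,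
      cons_val_zero, cons_val_one, cons_val]
    have hd : ∀ (s : Fin m) (f : Fin m → ℝ), ∑ t, d s t * f t = f s := by
      intro s f; simp [d]
    have h6 : ∀ s t v : Fin m, ∑ i, ∑ r, ∑ n, d s i * (d t r * (d v n *
          (a' i * b' r * c' n))) = a' s * b' t * c' v := by
      intro s t v
      simp only [← Finset.mul_sum, hd]
    rw [show (a' j * b' k * c' l - a' j * c' k * b' l - b' j * a' k * c' l + b' j * c' k * a' l
        + c' j * a' k * b' l - c' j * b' k * a' l)
        = (a' j * b' k * c' l) - (a' j * b' l * c' k) - (a' k * b' j * c' l) + (a' l * b' j * c' k)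
        + (a' k * b' l * c' j) - (a' l * b' k * c' j) by ring]
    rw [← h6 j k l, ← h6 j l k, ← h6 k j l, ← h6 l j k, ← h6 k l j, ← h6 l k j]
    simp only [Finset.mul_sum, ← Finset.sum_add_distrib, ← Finset.sum_sub_distrib]
    exact Finset.sum_congr rfl fun i _ => Finset.sum_congr rfl fun r _ =>
      Finset.sum_congr rfl fun n _ => by ring
  calc ∑ L, dualTriple L a b c * dualTriple L a' b' c'
      = ∑ j, ∑ k, ∑ l, ∑ i, ∑ r, ∑ n, (∑ L, eps j k l L * eps i r n L) *
          (a j * b k * c l * (a' i * b' r * c' n)) := by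
        simp only [h1]
        rw [Finset.sum_comm]; refine Finset.sum_congr rfl fun j _ => ?_
        rw [Finset.sum_comm]; refine Finset.sum_congr rfl fun k _ => ?_
        rw [Finset.sum_comm]; refine Finset.sum_congr rfl fun l _ => ?_
        rw [Finset.sum_comm]; refine Finset.sum_congr rfl fun i _ => ?_
        rw [Finset.sum_comm]; refine Finset.sum_congr rfl fun r _ => ?_
        rw [Finset.sum_comm]; refine Finset.sum_congr rfl fun n _ => ?_
        rw [Finset.sum_mul]
    _ = _ := by
        simp only [h2, ← Finset.mul_sum]
        congr 1
        have h6 : ∀ f g h : Fin m → ℝ, ∑ j, ∑ k, ∑ l, f j * (g k * h l)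
            = (∑ j, f j) * ((∑ k, g k) * ∑ l, h l) := by
          intro f g h
          simp only [← Finset.mul_sum, ← Finset.sum_mul]
        simp only [det_fin_three, of_apply, cons_val_zero, cons_val_one, cons_val, dotProduct,
          mul_assoc]
        simp only [← h6, ← Finset.sum_add_distrib, ← Finset.sum_sub_distrib]
        exact Finset.sum_congr rfl fun i _ => Finset.sum_congr rfl fun r _ =>
          Finset.sum_congr rfl fun n _ => by ring

/-! ### Calculus in a chart -/

section

variable {S : Type*} [TopologicalSpace S]
  {u : OpenPartialHomeomorph S (EuclideanSpace ℝ (Fin 2))}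

/-- `f` is smooth in the chart `u`: its coordinate expression is smooth on the range of the
chart. -/
def SmoothIn (u : OpenPartialHomeomorph S (EuclideanSpace ℝ (Fin 2))) (f : S → ℝ) : Prop :=
  ContDiffOn ℝ ∞ (f ∘ u.symm) u.target

namespace SmoothIn

variable {f h : S → ℝ}

theorem contDiffAt (hf : SmoothIn u f) {p : S} (hp : p ∈ u.source) :
    ContDiffAt ℝ ∞ (f ∘ u.symm) (u p) :=
  ContDiffOn.contDiffAt hf (u.open_target.mem_nhds (u.map_source hp))

theorem differentiableAt (hf : SmoothIn u f) {p : S} (hp : p ∈ u.source) :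
    DifferentiableAt ℝ (f ∘ u.symm) (u p) :=
  (hf.contDiffAt hp).differentiableAt (by simp)

theorem congr (hf : SmoothIn u f) (hfh : ∀ q ∈ u.source, h q = f q) : SmoothIn u h :=
  ContDiffOn.congr hf fun _ hy => hfh _ (u.map_target hy)

theorem const (c : ℝ) : SmoothIn u fun _ => c := contDiffOn_const

theorem sub (hf : SmoothIn u f) (hh : SmoothIn u h) : SmoothIn u fun q => f q - h q :=
  ContDiffOn.sub hf hh

theorem mul (hf : SmoothIn u f) (hh : SmoothIn u h) : SmoothIn u fun q => f q * h q :=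
  ContDiffOn.mul hf hh

theorem sum {ι : Type*} {s : Finset ι} {F : ι → S → ℝ} (hF : ∀ i ∈ s, SmoothIn u (F i)) :
    SmoothIn u fun q => ∑ i ∈ s, F i q :=
  ContDiffOn.sum hF

theorem inv (hf : SmoothIn u f) (h0 : ∀ q ∈ u.source, f q ≠ 0) : SmoothIn u fun q => (f q)⁻¹ :=
  ContDiffOn.inv hf fun _ hy => h0 _ (u.map_target hy)

theorem pd (hf : SmoothIn u f) (a : Fin 2) : SmoothIn u (pd u a f) := by
  have h1 : ContDiffOn ℝ ∞ (fun y => fderiv ℝ (f ∘ u.symm) y (EuclideanSpace.single a 1))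
      u.target :=
    (ContDiffOn.fderiv_of_isOpen hf u.open_target (m := ∞) (by simp)).clm_apply contDiffOn_const
  refine h1.congr fun y hy => ?_
  simp only [Function.comp_apply, PseudoSurface.pd, u.right_inv hy]

end SmoothIn

variable {f h : S → ℝ} {p : S}

theorem pd_congr (hp : p ∈ u.source) (hfh : ∀ q ∈ u.source, f q = h q) (a : Fin 2) :
    pd u a f p = pd u a h p := by
  have : f ∘ u.symm =ᶠ[nhds (u p)] h ∘ u.symm := by
    filter_upwards [u.open_target.mem_nhds (u.map_source hp)] with y hy
    exact hfh _ (u.map_target hy)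
  rw [pd, pd, this.fderiv_eq]

theorem pd_sub (hf : SmoothIn u f) (hh : SmoothIn u h) (hp : p ∈ u.source) (a : Fin 2) :
    pd u a (fun q => f q - h q) p = pd u a f p - pd u a h p := by
  have := fderiv_sub (hf.differentiableAt hp) (hh.differentiableAt hp)
  exact DFunLike.congr_fun this _

theorem pd_mul (hf : SmoothIn u f) (hh : SmoothIn u h) (hp : p ∈ u.source) (a : Fin 2) :
    pd u a (fun q => f q * h q) p = pd u a f p * h p + f p * pd u a h p := by
  have := DFunLike.congr_fun (fderiv_mul (hf.differentiableAt hp) (hh.differentiableAt hp))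
    (EuclideanSpace.single a 1)
  refine this.trans ?_
  simp only [add_apply, smul_apply, Function.comp_apply,
    u.left_inv hp, smul_eq_mul, pd]
  ring

theorem pd_sum {ι : Type*} {s : Finset ι} {F : ι → S → ℝ} (hF : ∀ i ∈ s, SmoothIn u (F i))
    (hp : p ∈ u.source) (a : Fin 2) :
    pd u a (fun q => ∑ i ∈ s, F i q) p = ∑ i ∈ s, pd u a (F i) p := by
  have := DFunLike.congr_fun (fderiv_fun_sum fun i hi => (hF i hi).differentiableAt hp)
    (EuclideanSpace.single a 1)
  refine this.trans ?_
  simp only [sum_apply, pd]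

theorem pd_const_mul (c : ℝ) (hf : SmoothIn u f) (hp : p ∈ u.source) (a : Fin 2) :
    pd u a (fun q => c * f q) p = c * pd u a f p := by
  have := DFunLike.congr_fun (fderiv_const_mul (hf.differentiableAt hp) c)
    (EuclideanSpace.single a 1)
  exact this

theorem pd_comm (hf : SmoothIn u f) (hp : p ∈ u.source) (a b : Fin 2) :
    pd u a (pd u b f) p = pd u b (pd u a f) p := by
  have hd : DifferentiableAt ℝ (fderiv ℝ (f ∘ u.symm)) (u p) :=
    ((ContDiffOn.fderiv_of_isOpen hf u.open_target (m := ∞) (by simp)).contDiffAt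
      (u.open_target.mem_nhds (u.map_source hp))).differentiableAt (by simp)
  have key : ∀ a b : Fin 2, pd u a (pd u b f) p
      = fderiv ℝ (fderiv ℝ (f ∘ u.symm)) (u p) (EuclideanSpace.single a 1)
        (EuclideanSpace.single b 1) := by
    intro a b
    have h1 : pd u b f ∘ u.symm =ᶠ[nhds (u p)]
        fun y => fderiv ℝ (f ∘ u.symm) y (EuclideanSpace.single b 1) := by
      filter_upwards [u.open_target.mem_nhds (u.map_source hp)] with y hy
      simp only [Function.comp_apply, pd, u.right_inv hy]
    rw [pd, h1.fderiv_eq, fderiv_clm_apply hd (differentiableAt_const _)]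
    simp
  rw [key, key]
  exact ((hf.contDiffAt hp).isSymmSndFDerivAt (by simpa using ENat.LEInfty.out)).eq _ _

end

/-! ### Coordinate vectors -/

section

variable {S : Type*} [TopologicalSpace S] [ChartedSpace (EuclideanSpace ℝ (Fin 2)) S]
  {u : OpenPartialHomeomorph S (EuclideanSpace ℝ (Fin 2))}

theorem mdifferentiable_of_mem_maximalAtlas (hu : u ∈ IsManifold.maximalAtlas (𝓡 2) ∞ S) :
    u.MDifferentiable (𝓡 2) (𝓡 2) :=
  ⟨(contMDiffOn_of_mem_maximalAtlas hu).mdifferentiableOn (by simp),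
    (contMDiffOn_symm_of_mem_maximalAtlas hu).mdifferentiableOn (by simp)⟩

theorem smoothIn_of_contMDiffOn (hu : u ∈ IsManifold.maximalAtlas (𝓡 2) ∞ S) {f : S → ℝ}
    (hf : ContMDiffOn (𝓡 2) 𝓘(ℝ, ℝ) ∞ f u.source) : SmoothIn u f :=
  (hf.comp (contMDiffOn_symm_of_mem_maximalAtlas hu) u.mapsTo_symm).contDiffOn

theorem exists_coordEquiv (hu : u ∈ IsManifold.maximalAtlas (𝓡 2) ∞ S) {p : S}
    (hp : p ∈ u.source) :
    ∃ e : TangentSpace (𝓡 2) p ≃L[ℝ] EuclideanSpace ℝ (Fin 2),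
      (∀ v, e v = mfderiv (𝓡 2) (𝓡 2) u p v) ∧
        ∀ a, coordVec u a p = e.symm (EuclideanSpace.single a 1) := by
  let e := (mdifferentiable_of_mem_maximalAtlas hu).mfderiv hp
  have he : (e : TangentSpace (𝓡 2) p →L[ℝ] TangentSpace (𝓡 2) (u p))
      = mfderiv (𝓡 2) (𝓡 2) u p := by
    ext v; rfl
  refine ⟨e, fun v => rfl, fun a => ?_⟩
  rw [coordVec, ← he, ContinuousLinearMap.inverse_equiv]
  rfl

theorem mfderiv_coordVec (hu : u ∈ IsManifold.maximalAtlas (𝓡 2) ∞ S) {p : S}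
    (hp : p ∈ u.source) (a : Fin 2) :
    mfderiv (𝓡 2) (𝓡 2) u p (coordVec u a p)
      = (EuclideanSpace.single a 1 : EuclideanSpace ℝ (Fin 2)) := by
  obtain ⟨e, he, hc⟩ := exists_coordEquiv hu hp
  rw [← he, hc, e.apply_symm_apply]

/-- The coordinate vectors span the tangent space. -/
theorem exists_coordVec_combination (hu : u ∈ IsManifold.maximalAtlas (𝓡 2) ∞ S) {p : S}
    (hp : p ∈ u.source) (v : TangentSpace (𝓡 2) p) :
    ∃ c : Fin 2 → ℝ, v = ∑ a, c a • coordVec u a p := by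
  obtain ⟨e, -, hc⟩ := exists_coordEquiv hu hp
  refine ⟨fun a => e v a, e.injective ?_⟩
  simp only [hc, map_sum, map_smul, e.apply_symm_apply]
  ext b
  fin_cases b <;> simp

/-- The coordinate vectors are linearly independent. -/
theorem coordVec_combination_eq_zero (hu : u ∈ IsManifold.maximalAtlas (𝓡 2) ∞ S) {p : S}
    (hp : p ∈ u.source) {c : Fin 2 → ℝ} (h0 : ∑ a, c a • coordVec u a p = 0) : c = 0 := by
  obtain ⟨e, -, hc⟩ := exists_coordEquiv hu hp
  have h1 := congrArg e h0
  simp only [hc, map_sum, map_smul, e.apply_symm_apply, map_zero] at h1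
  ext b
  have h2 := congrArg (fun w : EuclideanSpace ℝ (Fin 2) => w b) h1
  fin_cases b <;> simpa using h2

theorem mfderiv_apply_coordVec (hu : u ∈ IsManifold.maximalAtlas (𝓡 2) ∞ S) {p : S}
    (hp : p ∈ u.source) {E : Type*} [NormedAddCommGroup E] [NormedSpace ℝ E] {f : S → E}
    (hf : DifferentiableAt ℝ (f ∘ u.symm) (u p)) (a : Fin 2) :
    mfderiv (𝓡 2) 𝓘(ℝ, E) f p (coordVec u a p)
      = fderiv ℝ (f ∘ u.symm) (u p) (EuclideanSpace.single a 1) := by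
  have h1 : f =ᶠ[nhds p] (f ∘ u.symm) ∘ u := by
    filter_upwards [u.open_source.mem_nhds hp] with q hq
    simp only [Function.comp_apply, u.left_inv hq]
  have h2 : MDifferentiableAt (𝓡 2) 𝓘(ℝ, E) (f ∘ u.symm) (u p) := hf.mdifferentiableAt
  rw [h1.mfderiv_eq,
    mfderiv_comp p h2 ((mdifferentiable_of_mem_maximalAtlas hu).mdifferentiableAt hp)]
  have h3 : ∀ w, mfderiv (𝓡 2) 𝓘(ℝ, E) (f ∘ u.symm) (u p) w = fderiv ℝ (f ∘ u.symm) (u p) w := by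
    intro w; rw [mfderiv_eq_fderiv]; rfl
  exact (h3 _).trans (congrArg _ (mfderiv_coordVec hu hp a))

theorem mfderiv_coordVec_eq_pd (hu : u ∈ IsManifold.maximalAtlas (𝓡 2) ∞ S) {p : S}
    (hp : p ∈ u.source) {f : S → ℝ} (hf : SmoothIn u f) (a : Fin 2) :
    mfderiv (𝓡 2) 𝓘(ℝ, ℝ) f p (coordVec u a p) = pd u a f p :=
  mfderiv_apply_coordVec hu hp (hf.differentiableAt hp) a

end

/-! ### The symplectic form and the Poisson bracket in a chart -/

section

variable {S : Type*} [TopologicalSpace S] [ChartedSpace (EuclideanSpace ℝ (Fin 2)) S]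
  {u : OpenPartialHomeomorph S (EuclideanSpace ℝ (Fin 2))} {p : S}

theorem SymplecticForm.apply_swap (Ω : SymplecticForm S) (v w : TangentSpace (𝓡 2) p) :
    Ω.toFun p w v = -Ω.toFun p v w := by
  have h := Ω.alt p (v + w)
  simp only [map_add, add_apply, Ω.alt] at h
  linarith

theorem SymplecticForm.rho_ne_zero (Ω : SymplecticForm S)
    (hu : u ∈ IsManifold.maximalAtlas (𝓡 2) ∞ S) (hp : p ∈ u.source) : Ω.rho u p ≠ 0 := by
  intro h
  have h1 : coordVec u 0 p = 0 := by
    refine Ω.nondegenerate p _ fun w => ?_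
    obtain ⟨c, rfl⟩ := exists_coordVec_combination hu hp w
    rw [SymplecticForm.rho] at h
    simp [Fin.sum_univ_two, Ω.alt, h]
  have h2 : ∑ a, (![1, 0] : Fin 2 → ℝ) a • coordVec u a p = 0 := by
    simp [Fin.sum_univ_two, h1]
  have h3 := congrFun (coordVec_combination_eq_zero hu hp h2) 0
  simp at h3

theorem SymplecticForm.smoothIn_rho (Ω : SymplecticForm S)
    (hu : u ∈ IsManifold.maximalAtlas (𝓡 2) ∞ S) : SmoothIn u (Ω.rho u) :=
  smoothIn_of_contMDiffOn hu (Ω.smooth u hu)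

/-- `{f, h} = ρ⁻¹ (∂₁f ∂₂h - ∂₂f ∂₁h)`. -/
theorem SymplecticForm.bracket_eq (Ω : SymplecticForm S)
    (hu : u ∈ IsManifold.maximalAtlas (𝓡 2) ∞ S) (hp : p ∈ u.source) {f h : S → ℝ}
    (hf : SmoothIn u f) (hh : SmoothIn u h) :
    Ω.bracket f h p = (Ω.rho u p)⁻¹ * (pd u 0 f p * pd u 1 h p - pd u 1 f p * pd u 0 h p) := by
  have hρ := Ω.rho_ne_zero hu hp
  have key : ∀ {f : S → ℝ}, SmoothIn u f → ∀ a,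
      Ω.toFun p (Ω.hamiltonian f p) (coordVec u a p) = pd u a f p := fun hf a => by
    rw [Ω.hamiltonian_spec]
    exact mfderiv_coordVec_eq_pd hu hp hf a
  obtain ⟨c, hc⟩ := exists_coordVec_combination hu hp (Ω.hamiltonian h p)
  have h10 : Ω.toFun p (coordVec u 1 p) (coordVec u 0 p) = -Ω.rho u p := Ω.apply_swap _ _
  have h01 : Ω.toFun p (coordVec u 0 p) (coordVec u 1 p) = Ω.rho u p := rfl
  have h0 := key hh 0
  have h1 := key hh 1
  rw [hc] at h0 h1
  simp only [Fin.sum_univ_two, map_add, map_smul, add_apply, smul_apply, Ω.alt, h10, h01,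
    smul_eq_mul, mul_zero, zero_add, add_zero] at h0 h1
  rw [SymplecticForm.bracket, hc]
  simp only [Fin.sum_univ_two, map_add, map_smul, smul_eq_mul, key hf]
  rw [← h0, ← h1]
  field_simp
  ring

end

/-! ### The induced metric in a chart -/

section

variable {m : ℕ} (ν : ℕ)

theorem scal_add_left (v v' w : Fin m → ℝ) : scal ν (v + v') w = scal ν v w + scal ν v' w := by
  simp only [scal, ← Finset.sum_add_distrib, Pi.add_apply]
  exact Finset.sum_congr rfl fun i _ => by ring

theorem scal_smul_left (t : ℝ) (v w : Fin m → ℝ) : scal ν (t • v) w = t * scal ν v w := by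
  simp only [scal, Finset.mul_sum, Pi.smul_apply, smul_eq_mul]
  exact Finset.sum_congr rfl fun i _ => by ring

theorem scal_comm (v w : Fin m → ℝ) : scal ν v w = scal ν w v :=
  Finset.sum_congr rfl fun i _ => by ring

theorem scal_add_right (v w w' : Fin m → ℝ) : scal ν v (w + w') = scal ν v w + scal ν v w' := by
  rw [scal_comm, scal_add_left, scal_comm ν w, scal_comm ν w']

theorem scal_smul_right (t : ℝ) (v w : Fin m → ℝ) : scal ν v (t • w) = t * scal ν v w := by
  rw [scal_comm, scal_smul_left, scal_comm]

end

section

variable {S : Type*} [TopologicalSpace S] [ChartedSpace (EuclideanSpace ℝ (Fin 2)) S]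
  {u : OpenPartialHomeomorph S (EuclideanSpace ℝ (Fin 2))} {p : S} {m : ℕ} {ν : ℕ}
  {x : S → Fin m → ℝ}

theorem smoothIn_comp_apply (hu : u ∈ IsManifold.maximalAtlas (𝓡 2) ∞ S)
    (hx : ContMDiff (𝓡 2) 𝓘(ℝ, Fin m → ℝ) ∞ x) (i : Fin m) : SmoothIn u fun q => x q i := by
  have h : ContDiffOn ℝ ∞ (x ∘ u.symm) u.target :=
    (hx.comp_contMDiffOn (contMDiffOn_symm_of_mem_maximalAtlas hu)).contDiffOn
  exact contDiffOn_pi.1 h i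

theorem frame_eq_mfderiv (hu : u ∈ IsManifold.maximalAtlas (𝓡 2) ∞ S)
    (hx : ContMDiff (𝓡 2) 𝓘(ℝ, Fin m → ℝ) ∞ x) (hp : p ∈ u.source) (a : Fin 2) :
    mfderiv (𝓡 2) 𝓘(ℝ, Fin m → ℝ) x p (coordVec u a p) = frame x u a p := by
  have hd : ∀ i, DifferentiableAt ℝ (fun y => (x ∘ u.symm) y i) (u p) := fun i =>
    (smoothIn_comp_apply hu hx i).differentiableAt hp
  refine (mfderiv_apply_coordVec hu hp (differentiableAt_pi.2 hd) a).trans ?_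
  funext i
  rw [fderiv_pi hd]
  rfl

theorem gdet_ne_zero (hu : u ∈ IsManifold.maximalAtlas (𝓡 2) ∞ S)
    (hx : ContMDiff (𝓡 2) 𝓘(ℝ, Fin m → ℝ) ∞ x) (hg : IsPseudoRiemannian ν x)
    (hp : p ∈ u.source) : gdet ν x u p ≠ 0 := by
  intro h0
  obtain ⟨c, hc, hc0⟩ := Matrix.exists_vecMul_eq_zero_iff.2 h0
  refine hc (coordVec_combination_eq_zero hu hp (hg p _ fun w => ?_))
  obtain ⟨d, rfl⟩ := exists_coordVec_combination hu hp w
  have hsum : ∀ c : Fin 2 → ℝ, mfderiv (𝓡 2) 𝓘(ℝ, Fin m → ℝ) x p (∑ a, c a • coordVec u a p)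
      = c 0 • frame x u 0 p + c 1 • frame x u 1 p := by
    intro c
    rw [← frame_eq_mfderiv hu hx hp, ← frame_eq_mfderiv hu hx hp, Fin.sum_univ_two, map_add,
      map_smul, map_smul]
    rfl
  rw [hsum, hsum]
  have h1 := congrFun hc0 0
  have h2 := congrFun hc0 1
  simp only [Matrix.vecMul, dotProduct, Fin.sum_univ_two, metric, Matrix.of_apply,
    Pi.zero_apply] at h1 h2
  simp only [scal_add_left, scal_add_right, scal_smul_left, scal_smul_right]
  linear_combination d 0 * h1 + d 1 * h2

end

/-! ### The Gauss equation -/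

section

variable {S : Type*} [TopologicalSpace S] {u : OpenPartialHomeomorph S (EuclideanSpace ℝ (Fin 2))}
  {p : S} {m : ℕ} {ν : ℕ}

/-- The componentwise partial derivative of a vector-valued function. -/
def pdVec (u : OpenPartialHomeomorph S (EuclideanSpace ℝ (Fin 2))) (a : Fin 2)
    (V : S → Fin m → ℝ) (p : S) : Fin m → ℝ :=
  fun i => pd u a (fun q => V q i) p

/-- Componentwise smoothness in the chart `u` of a vector-valued function. -/
def SmoothVecIn (u : OpenPartialHomeomorph S (EuclideanSpace ℝ (Fin 2))) (V : S → Fin m → ℝ) :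
    Prop :=
  ∀ i, SmoothIn u fun q => V q i

variable {V W x : S → Fin m → ℝ}

theorem SmoothVecIn.pdVec (hV : SmoothVecIn u V) (a : Fin 2) : SmoothVecIn u (pdVec u a V) :=
  fun i => (hV i).pd a

theorem SmoothVecIn.frame (hx : SmoothVecIn u x) (a : Fin 2) : SmoothVecIn u (frame x u a) :=
  hx.pdVec a

theorem SmoothVecIn.scal (ν : ℕ) (hV : SmoothVecIn u V) (hW : SmoothVecIn u W) :
    SmoothIn u fun q => scal ν (V q) (W q) :=
  SmoothIn.sum fun i _ => ((SmoothIn.const _).mul (hV i)).mul (hW i)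

theorem pdVec_comm (hV : SmoothVecIn u V) (hp : p ∈ u.source) (a b : Fin 2) :
    pdVec u a (pdVec u b V) p = pdVec u b (pdVec u a V) p :=
  funext fun i => pd_comm (hV i) hp a b

theorem pd_scal (hV : SmoothVecIn u V) (hW : SmoothVecIn u W) (hp : p ∈ u.source) (a : Fin 2) :
    pd u a (fun q => scal ν (V q) (W q)) p
      = scal ν (pdVec u a V p) (W p) + scal ν (V p) (pdVec u a W p) := by
  have h : ∀ i, SmoothIn u fun q => gbar ν i * V q i := fun i => (SmoothIn.const _).mul (hV i)
  simp only [scal, ← Finset.sum_add_distrib]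
  rw [pd_sum (fun i _ => (h i).mul (hW i)) hp]
  refine Finset.sum_congr rfl fun i _ => ?_
  rw [pd_mul (h i) (hW i) hp, pd_const_mul _ (hV i) hp]
  rfl

/-- The vector `∂_a ∂_b x` of second derivatives in the chart `u`. -/
def hess (x : S → Fin m → ℝ) (u : OpenPartialHomeomorph S (EuclideanSpace ℝ (Fin 2)))
    (a b : Fin 2) : S → Fin m → ℝ := pdVec u a (frame x u b)

theorem SmoothVecIn.hess (hx : SmoothVecIn u x) (a b : Fin 2) : SmoothVecIn u (hess x u a b) :=
  (hx.frame b).pdVec a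

theorem hess_comm (hx : SmoothVecIn u x) (hp : p ∈ u.source) (a b : Fin 2) :
    hess x u a b p = hess x u b a p :=
  pdVec_comm hx hp a b

theorem pdVec_hess_comm (hx : SmoothVecIn u x) (hp : p ∈ u.source) (a b c : Fin 2) :
    pdVec u a (hess x u b c) p = pdVec u b (hess x u a c) p :=
  pdVec_comm (hx.frame c) hp a b

theorem metric_symm (a b : Fin 2) : metric ν x u p a b = metric ν x u p b a :=
  scal_comm ν _ _

theorem gdet_eq : gdet ν x u p
    = metric ν x u p 0 0 * metric ν x u p 1 1 - metric ν x u p 0 1 * metric ν x u p 0 1 := by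
  rw [gdet, Matrix.det_fin_two, metric_symm 1 0]

theorem metric_inv : (metric ν x u p)⁻¹ =
    (gdet ν x u p)⁻¹ • !![metric ν x u p 1 1, -metric ν x u p 0 1;
      -metric ν x u p 0 1, metric ν x u p 0 0] := by
  rw [Matrix.inv_def, Ring.inverse_eq_inv', Matrix.adjugate_fin_two, metric_symm 1 0]
  rfl

theorem smoothIn_metric (hx : SmoothVecIn u x) (a b : Fin 2) :
    SmoothIn u fun q => metric ν x u q a b :=
  (hx.frame a).scal ν (hx.frame b)

theorem smoothIn_gdet (hx : SmoothVecIn u x) : SmoothIn u (gdet ν x u) :=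
  (((smoothIn_metric hx 0 0).mul (smoothIn_metric hx 1 1)).sub
    ((smoothIn_metric hx 0 1).mul (smoothIn_metric hx 0 1))).congr fun _ _ => gdet_eq

theorem pd_metric (hx : SmoothVecIn u x) (hp : p ∈ u.source) (a b c : Fin 2) :
    pd u a (fun q => metric ν x u q b c) p
      = scal ν (hess x u a b p) (frame x u c p) + scal ν (frame x u b p) (hess x u a c p) :=
  pd_scal (hx.frame b) (hx.frame c) hp a

/-- `Γ^c_{ab} = g^{cd} ⟨∂_a ∂_b x, e_d⟩`: the Levi-Civita connection is the tangential part of the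
flat one. -/
theorem christoffel_eq (hx : SmoothVecIn u x) (hp : p ∈ u.source) (c a b : Fin 2) :
    christoffel ν x u c a b p
      = ∑ d, (metric ν x u p)⁻¹ c d * scal ν (hess x u a b p) (frame x u d p) := by
  rw [christoffel, Finset.mul_sum]
  refine Finset.sum_congr rfl fun d _ => ?_
  rw [pd_metric hx hp, pd_metric hx hp, pd_metric hx hp, hess_comm hx hp b a,
    hess_comm hx hp d a, hess_comm hx hp d b, scal_comm ν (frame x u b p)]
  ring

theorem smoothIn_christoffel (hx : SmoothVecIn u x) (h0 : ∀ q ∈ u.source, gdet ν x u q ≠ 0)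
    (c a b : Fin 2) : SmoothIn u (christoffel ν x u c a b) := by
  have hinv : ∀ d, SmoothIn u fun q => (metric ν x u q)⁻¹ c d := by
    have hg : SmoothIn u fun q => (gdet ν x u q)⁻¹ := (smoothIn_gdet hx).inv h0
    have hm := smoothIn_metric (ν := ν) hx
    intro d
    simp only [metric_inv]
    fin_cases c <;> fin_cases d
    · exact hg.mul (hm 1 1)
    · exact hg.mul (((SmoothIn.const (-1)).mul (hm 0 1)).congr fun q _ => by simp)
    · exact hg.mul (((SmoothIn.const (-1)).mul (hm 0 1)).congr fun q _ => by simp)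
    · exact hg.mul (hm 0 0)
  exact (SmoothIn.sum (s := Finset.univ) fun d _ =>
    (hinv d).mul ((hx.hess a b).scal ν (hx.frame d))).congr fun q hq => christoffel_eq hx hq c a b

/-- Lowering the upper index of the Christoffel symbols gives `⟨∂_a ∂_b x, e_d⟩`. -/
theorem sum_christoffel_mul_metric (hx : SmoothVecIn u x) (h0 : gdet ν x u p ≠ 0)
    (hp : p ∈ u.source) (a b d : Fin 2) :
    ∑ c, christoffel ν x u c a b p * metric ν x u p c d
      = scal ν (hess x u a b p) (frame x u d p) := by
  simp only [christoffel_eq hx hp, metric_inv, Fin.sum_univ_two]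
  fin_cases d <;> simp [metric_symm (p := p) (x := x) (u := u) (ν := ν) 1 0] <;> field_simp <;>
    rw [gdet_eq] <;> ring

/-- The derivative along `e` of `Γ^c_{ab} g_{cd} = ⟨∂_a ∂_b x, e_d⟩`. -/
theorem sum_pd_christoffel_mul_metric (hx : SmoothVecIn u x)
    (h0 : ∀ q ∈ u.source, gdet ν x u q ≠ 0) (hp : p ∈ u.source) (e a b d : Fin 2) :
    ∑ c, pd u e (christoffel ν x u c a b) p * metric ν x u p c d
      = scal ν (pdVec u e (hess x u a b) p) (frame x u d p)
        + scal ν (hess x u a b p) (hess x u e d p)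
        - ∑ c, christoffel ν x u c a b p * (scal ν (hess x u e c p) (frame x u d p)
          + scal ν (frame x u c p) (hess x u e d p)) := by
  have hΓ : ∀ c, SmoothIn u (christoffel ν x u c a b) := fun c => smoothIn_christoffel hx h0 c a b
  have h1 := pd_congr hp (fun q hq => sum_christoffel_mul_metric hx (h0 q hq) hq a b d) e
  rw [pd_scal (hx.hess a b) (hx.frame d) hp,
    pd_sum (fun c _ => (hΓ c).mul (smoothIn_metric hx c d)) hp] at h1
  simp only [pd_mul (hΓ _) (smoothIn_metric hx _ d) hp, pd_metric hx hp,
    Finset.sum_add_distrib] at h1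
  exact eq_sub_of_add_eq h1

/-- The Gauss equation: the determinant of the induced metric times the intrinsic curvature is
`⟨II₁₁, II₂₂⟩ - ⟨II₁₂, II₁₂⟩`, written out in terms of second derivatives of `x`. -/
theorem gdet_mul_gaussCurvature (hx : SmoothVecIn u x)
    (h0 : ∀ q ∈ u.source, gdet ν x u q ≠ 0) (hp : p ∈ u.source) :
    gdet ν x u p * gaussCurvature ν x u p
      = scal ν (hess x u 0 0 p) (hess x u 1 1 p) - scal ν (hess x u 0 1 p) (hess x u 0 1 p)
        - ∑ c, christoffel ν x u c 0 0 p * scal ν (hess x u 1 1 p) (frame x u c p)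
        + ∑ c, christoffel ν x u c 0 1 p * scal ν (hess x u 0 1 p) (frame x u c p) := by
  have h1 := sum_pd_christoffel_mul_metric hx h0 hp 1 0 0 1
  have h2 := sum_pd_christoffel_mul_metric hx h0 hp 0 1 0 1
  have hL := fun a b => sum_christoffel_mul_metric hx (h0 p hp) hp a b 1
  have hΓ : ∀ c, christoffel ν x u c 1 0 p = christoffel ν x u c 0 1 p := fun c => by
    rw [christoffel_eq hx hp, christoffel_eq hx hp, hess_comm hx hp 1 0]
  -- The third derivatives of `x` in `h1` and `h2` now agree and cancel.
  rw [pdVec_hess_comm hx hp 1 0] at h1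
  rw [gaussCurvature, mul_div_cancel₀ _ (h0 p hp)]
  simp only [riemann, Fin.sum_univ_two] at h1 h2 hL ⊢
  have hL00 := hL 0 0
  have hL01 := hL 0 1
  have hL10 := hL 1 0
  have hL11 := hL 1 1
  simp only [hess_comm hx hp 1 0, hΓ, scal_comm ν (frame x u _ p)] at *
  linear_combination h1 - h2 + christoffel ν x u 0 0 0 p * hL01 + christoffel ν x u 1 0 0 p * hL11
    - christoffel ν x u 0 0 1 p * hL00 - christoffel ν x u 1 0 1 p * hL01

end

/-! ### Derivatives of the Poisson bivector -/

/-- The derivative, by the product rule, of the bivector `τ e₁ ∧ e₂`, where `σ` is the derivative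
of `τ` and `A₁`, `A₂` are those of `e₁`, `e₂`. -/
def bivectorDeriv {m : ℕ} (σ τ : ℝ) (e₁ e₂ A₁ A₂ : Fin m → ℝ) (k l : Fin m) : ℝ :=
  σ * (e₁ k * e₂ l - e₂ k * e₁ l)
    + τ * (A₁ k * e₂ l + e₁ k * A₂ l - A₂ k * e₁ l - e₂ k * A₁ l)

section

variable {m : ℕ} (L : Fin (m - 3) → Fin m) (σ τ : ℝ) (a e₁ e₂ A₁ A₂ : Fin m → ℝ)

theorem dualWedge_bivectorDeriv (hm : 3 ≤ m) :
    dualWedge L a (bivectorDeriv σ τ e₁ e₂ A₁ A₂)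
      = 2 * σ * dualTriple L a e₁ e₂
        - 2 * τ * (dualTriple L a e₂ A₁ - dualTriple L a e₁ A₂) := by
  have h : dualWedge L a (bivectorDeriv σ τ e₁ e₂ A₁ A₂)
      = σ * (dualTriple L a e₁ e₂ - dualTriple L a e₂ e₁)
        + τ * (dualTriple L a A₁ e₂ + dualTriple L a e₁ A₂ - dualTriple L a A₂ e₁
          - dualTriple L a e₂ A₁) := by
    simp only [dualTriple, dualWedge, bivectorDeriv, Finset.mul_sum, ← Finset.sum_add_distrib,
      ← Finset.sum_sub_distrib]
    exact Finset.sum_congr rfl fun j _ => Finset.sum_congr rfl fun k _ =>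
      Finset.sum_congr rfl fun l _ => by ring
  rw [h, dualTriple_swap_right L hm a e₁ e₂, dualTriple_swap_right L hm a e₂ A₁,
    dualTriple_swap_right L hm a e₁ A₂]
  ring

/-- Wedging with `e₁` kills the derivative of the coefficient `τ` and that of `e₂`. -/
theorem dualWedge_fst_bivectorDeriv (hm : 3 ≤ m) :
    dualWedge L e₁ (bivectorDeriv σ τ e₁ e₂ A₁ A₂) = -2 * τ * dualTriple L e₁ e₂ A₁ := by
  rw [dualWedge_bivectorDeriv L _ _ _ _ _ _ _ hm, dualTriple_self_left L hm,
    dualTriple_self_left L hm]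
  ring

/-- Wedging with `e₂` kills the derivative of the coefficient `τ` and that of `e₁`. -/
theorem dualWedge_snd_bivectorDeriv (hm : 3 ≤ m) :
    dualWedge L e₂ (bivectorDeriv σ τ e₁ e₂ A₁ A₂) = -2 * τ * dualTriple L e₁ e₂ A₂ := by
  rw [dualWedge_bivectorDeriv L _ _ _ _ _ _ _ hm, dualTriple_self_outer L hm,
    dualTriple_self_left L hm, dualTriple_swap_left L hm e₁ e₂]
  ring

end

section

variable {S : Type*} [TopologicalSpace S] [ChartedSpace (EuclideanSpace ℝ (Fin 2)) S]
  {u : OpenPartialHomeomorph S (EuclideanSpace ℝ (Fin 2))} {p : S} {m : ℕ} {x : S → Fin m → ℝ}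
  (Ω : SymplecticForm S)

theorem bracket_coord (hu : u ∈ IsManifold.maximalAtlas (𝓡 2) ∞ S) (hx : SmoothVecIn u x)
    (hp : p ∈ u.source) (k l : Fin m) :
    Ω.bracket (fun q => x q k) (fun q => x q l) p
      = (Ω.rho u p)⁻¹ * (frame x u 0 p k * frame x u 1 p l - frame x u 1 p k * frame x u 0 p l) :=
  Ω.bracket_eq hu hp (hx k) (hx l)

/-- The iterated bracket `{x^i, {x^k, x^l}}` in a chart. The derivatives `σ` of `ρ⁻¹` drop out of
all further computations. -/
theorem bracket_coord_bracket_coord (hu : u ∈ IsManifold.maximalAtlas (𝓡 2) ∞ S)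
    (hx : SmoothVecIn u x) (hp : p ∈ u.source) :
    ∃ σ : Fin 2 → ℝ, ∀ i k l : Fin m,
      Ω.bracket (fun q => x q i) (Ω.bracket (fun q => x q k) (fun q => x q l)) p
        = (Ω.rho u p)⁻¹ *
          (frame x u 0 p i * bivectorDeriv (σ 1) (Ω.rho u p)⁻¹ (frame x u 0 p) (frame x u 1 p)
              (hess x u 1 0 p) (hess x u 1 1 p) k l
            - frame x u 1 p i * bivectorDeriv (σ 0) (Ω.rho u p)⁻¹ (frame x u 0 p) (frame x u 1 p)
              (hess x u 0 0 p) (hess x u 0 1 p) k l) := by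
  have hτ : SmoothIn u fun q => (Ω.rho u q)⁻¹ :=
    (Ω.smoothIn_rho hu).inv fun q hq => Ω.rho_ne_zero hu hq
  refine ⟨fun a => pd u a (fun q => (Ω.rho u q)⁻¹) p, fun i k l => ?_⟩
  have h1 := (hx.frame 0 k).mul (hx.frame 1 l)
  have h2 := (hx.frame 1 k).mul (hx.frame 0 l)
  have hb : ∀ q ∈ u.source, Ω.bracket (fun q => x q k) (fun q => x q l) q
      = (Ω.rho u q)⁻¹ * (frame x u 0 q k * frame x u 1 q l - frame x u 1 q k * frame x u 0 q l) :=
    fun q hq => bracket_coord Ω hu hx hq k l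
  have hpd : ∀ a, pd u a (Ω.bracket (fun q => x q k) (fun q => x q l)) p
      = bivectorDeriv (pd u a (fun q => (Ω.rho u q)⁻¹) p) (Ω.rho u p)⁻¹ (frame x u 0 p)
          (frame x u 1 p) (hess x u a 0 p) (hess x u a 1 p) k l := by
    intro a
    rw [pd_congr hp hb, pd_mul hτ (h1.sub h2) hp, pd_sub h1 h2 hp,
      pd_mul (hx.frame 0 k) (hx.frame 1 l) hp, pd_mul (hx.frame 1 k) (hx.frame 0 l) hp]
    simp only [bivectorDeriv, hess, pdVec]
    ring
  rw [Ω.bracket_eq hu hp (hx i) ((hτ.mul (h1.sub h2)).congr hb), hpd, hpd]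
  rfl

end

/-! ### Factoring the multiple sums -/

section

variable {m : ℕ} (ν : ℕ) (L : Fin (m - 3) → Fin m)

/-- Lowering the index of a vector with the metric of `ℝ^m_ν`. -/
def lower (v : Fin m → ℝ) : Fin m → ℝ := fun i => gbar ν i * v i

theorem dotProduct_lower (v w : Fin m → ℝ) : dotProduct v (lower ν w) = scal ν v w :=
  Finset.sum_congr rfl fun i _ => by rw [lower]; ring

theorem bivectorDeriv_lower (σ τ : ℝ) (e₁ e₂ A₁ A₂ : Fin m → ℝ) (k l : Fin m) :
    bivectorDeriv σ τ (lower ν e₁) (lower ν e₂) (lower ν A₁) (lower ν A₂) k l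
      = gbar ν k * gbar ν l * bivectorDeriv σ τ e₁ e₂ A₁ A₂ k l := by
  simp only [bivectorDeriv, lower]
  ring

theorem dualWedge_mul_dualWedge (a b : Fin m → ℝ) (M N : Fin m → Fin m → ℝ) :
    dualWedge L a M * dualWedge L b N = ∑ i, ∑ j, ∑ k, ∑ l, ∑ r, ∑ n,
      eps j k l L * a j * M k l * (eps i r n L * b i * N r n) := by
  rw [mul_comm, dualWedge, dualWedge, Finset.sum_mul_sum]
  refine Finset.sum_congr rfl fun i _ => Finset.sum_congr rfl fun j _ => ?_
  rw [mul_comm]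
  simp only [Finset.sum_mul]
  simp only [Finset.mul_sum]

theorem scal_mul_dualWedge_mul (v w a : Fin m → ℝ) (M : Fin m → Fin m → ℝ) (k' : Fin m)
    (N : Fin m → Fin m → ℝ) :
    scal ν v w * dualWedge L a M * dualWedge L (Pi.single k' 1) N
      = ∑ i, ∑ j, ∑ k, ∑ l, ∑ r, ∑ n,
        eps k' k l L * N k l * (eps i r n L * a i * M r n) * (gbar ν j * v j * w j) := by
  have h : dualWedge L (Pi.single k' 1) N = ∑ k, ∑ l, eps k' k l L * N k l := by
    rw [dualWedge, Finset.sum_eq_single k']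
    · simp
    · intro j _ hj
      simp [hj]
    · simp
  have h2 : ∀ i j : Fin m, ∑ k, ∑ l, ∑ r, ∑ n,
        eps k' k l L * N k l * (eps i r n L * a i * M r n) * (gbar ν j * v j * w j)
      = (∑ k, ∑ l, eps k' k l L * N k l) * ((∑ r, ∑ n, eps i r n L * a i * M r n)
        * (gbar ν j * v j * w j)) := by
    intro i j
    simp only [Finset.sum_mul]
    simp only [Finset.mul_sum]
    exact Finset.sum_congr rfl fun k _ => Finset.sum_congr rfl fun l _ =>
      Finset.sum_congr rfl fun r _ => Finset.sum_congr rfl fun n _ => by ring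
  rw [h]
  simp only [h2, dualWedge, scal]
  simp only [← Finset.mul_sum, ← Finset.sum_mul]
  ring

variable (t : ℝ) (e₁ e₂ : Fin m → ℝ) (c₁ c₂ : Fin m → Fin m → ℝ)

/-- The multiple sum in the formula for the Gauss curvature, for fixed `L`. -/
theorem sum_curvature_factor :
    (∑ i, ∑ j, ∑ k, ∑ l, ∑ r, ∑ n,
      gbar ν i * gbar ν r * gbar ν n * eps j k l L * eps i r n L *
        (t * (e₁ i * c₂ k l - e₂ i * c₁ k l)) * (t * (e₁ j * c₂ r n - e₂ j * c₁ r n)))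
      = t ^ 2 * (dualWedge L e₁ c₂ *
          dualWedge L (lower ν e₁) (fun r n => gbar ν r * gbar ν n * c₂ r n)
        - dualWedge L e₂ c₂ * dualWedge L (lower ν e₁) (fun r n => gbar ν r * gbar ν n * c₁ r n)
        - dualWedge L e₁ c₁ * dualWedge L (lower ν e₂) (fun r n => gbar ν r * gbar ν n * c₂ r n)
        + dualWedge L e₂ c₁ * dualWedge L (lower ν e₂)
          (fun r n => gbar ν r * gbar ν n * c₁ r n)) := by
  simp only [dualWedge_mul_dualWedge, ← Finset.sum_add_distrib, ← Finset.sum_sub_distrib,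
    Finset.mul_sum]
  exact Finset.sum_congr rfl fun i _ => Finset.sum_congr rfl fun j _ =>
    Finset.sum_congr rfl fun k _ => Finset.sum_congr rfl fun l _ =>
    Finset.sum_congr rfl fun r _ => Finset.sum_congr rfl fun n _ => by simp only [lower]; ring

/-- The multiple sum in the formula for the mean curvature vector, for fixed `L`. -/
theorem sum_meanCurvature_factor (hm : 3 ≤ m) (k' : Fin m) :
    (∑ i, ∑ j, ∑ k, ∑ l, ∑ r, ∑ n,
      gbar ν j * gbar ν k * gbar ν l * eps i r n L * eps k' k l L *
        (t * (e₁ i * e₂ j - e₂ i * e₁ j)) * (t * (e₁ j * c₂ r n - e₂ j * c₁ r n)) *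
        (t * (e₁ k * e₂ l - e₂ k * e₁ l)))
      = 2 * t ^ 3 * ((scal ν e₁ e₂ * dualWedge L e₁ c₂ - scal ν e₂ e₂ * dualWedge L e₁ c₁
        - scal ν e₁ e₁ * dualWedge L e₂ c₂ + scal ν e₁ e₂ * dualWedge L e₂ c₁)
        * dualTriple L (lower ν e₁) (lower ν e₂) (Pi.single k' 1)) := by
  -- `N` is the bivector `e₁ ∧ e₂` with lowered indices; `σ = 1`, `τ = 0` puts it into the form that
  -- `dualWedge_bivectorDeriv` treats.
  let N : Fin m → Fin m → ℝ := bivectorDeriv 1 0 (lower ν e₁) (lower ν e₂) 0 0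
  have hN : dualWedge L (Pi.single k' 1) N
      = 2 * dualTriple L (lower ν e₁) (lower ν e₂) (Pi.single k' 1) := by
    rw [dualWedge_bivectorDeriv L _ _ _ _ _ _ _ hm, dualTriple_swap_left L hm,
      dualTriple_swap_right L hm]
    ring
  have h : ∀ s : ℝ, 2 * t ^ 3 * (s * dualTriple L (lower ν e₁) (lower ν e₂) (Pi.single k' 1))
      = t ^ 3 * (s * dualWedge L (Pi.single k' 1) N) := fun s => by rw [hN]; ring
  rw [h]
  simp only [add_mul, sub_mul, scal_mul_dualWedge_mul, ← Finset.sum_add_distrib,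
    ← Finset.sum_sub_distrib, Finset.mul_sum]
  exact Finset.sum_congr rfl fun i _ => Finset.sum_congr rfl fun j _ =>
    Finset.sum_congr rfl fun k _ => Finset.sum_congr rfl fun l _ =>
    Finset.sum_congr rfl fun r _ => Finset.sum_congr rfl fun n _ => by
      simp only [N, bivectorDeriv, lower]; ring

/-- The Gram determinant of `(e₁, e₂, D)` against `(e₁, e₂, D')` in `ℝ^m_ν`, as a sum over `L`. -/
theorem sum_dualTriple_mul_lower (hm : 3 ≤ m) (D D' : Fin m → ℝ) :
    ∑ L, dualTriple L e₁ e₂ D * dualTriple L (lower ν e₁) (lower ν e₂) (lower ν D')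
      = ((m - 3)! : ℝ) *
        ((scal ν e₁ e₁ * scal ν e₂ e₂ - scal ν e₁ e₂ * scal ν e₁ e₂) * scal ν D D'
          - scal ν e₂ e₂ * scal ν D e₁ * scal ν D' e₁
          + scal ν e₁ e₂ * (scal ν D e₁ * scal ν D' e₂ + scal ν D e₂ * scal ν D' e₁)
          - scal ν e₁ e₁ * scal ν D e₂ * scal ν D' e₂) := by
  rw [sum_dualTriple_mul hm]
  simp only [dotProduct_lower, Matrix.det_fin_three, Matrix.of_apply, Matrix.cons_val_zero,
    Matrix.cons_val_one, Matrix.cons_val, scal_comm ν e₂ e₁, scal_comm ν e₁ D', scal_comm ν e₂ D']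
  ring

/-- The Gram determinant of `(e₁, e₂, D)` against `(e₁, e₂, ∂_{k'})`, as a sum over `L`: the
`k'`-th component of the normal part of `D`, up to the factor `⟨e₁ ∧ e₂, e₁ ∧ e₂⟩`. -/
theorem sum_dualTriple_mul_single (hm : 3 ≤ m) (D : Fin m → ℝ) (k' : Fin m) :
    ∑ L, dualTriple L e₁ e₂ D * dualTriple L (lower ν e₁) (lower ν e₂) (Pi.single k' 1)
      = ((m - 3)! : ℝ) *
        ((scal ν e₁ e₁ * scal ν e₂ e₂ - scal ν e₁ e₂ * scal ν e₁ e₂) * D k'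
          - scal ν e₂ e₂ * scal ν D e₁ * e₁ k'
          + scal ν e₁ e₂ * (scal ν D e₁ * e₂ k' + scal ν D e₂ * e₁ k')
          - scal ν e₁ e₁ * scal ν D e₂ * e₂ k') := by
  rw [sum_dualTriple_mul hm]
  simp only [dotProduct_lower, Matrix.det_fin_three, Matrix.of_apply, Matrix.cons_val_zero,
    Matrix.cons_val_one, Matrix.cons_val, dotProduct_single_one, scal_comm ν e₂ e₁]
  ring

end

end PseudoSurface

end

open PseudoSurface in
theorem theorem3p7 (m ν : ℕ) (hm : 3 ≤ m) (hν : ν ≤ m)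
    {S : Type*} [TopologicalSpace S] [ChartedSpace (EuclideanSpace ℝ (Fin 2)) S]
    [IsManifold (𝓡 2) ∞ S]
    (x : S → Fin m → ℝ)
    (hx : Manifold.IsSmoothEmbedding (𝓡 2) 𝓘(ℝ, Fin m → ℝ) ∞ x)
    (hg : IsPseudoRiemannian ν x)
    (Ω : SymplecticForm S)
    (u : OpenPartialHomeomorph S (EuclideanSpace ℝ (Fin 2)))
    (hu : u ∈ IsManifold.maximalAtlas (𝓡 2) ∞ S)
    (p : S) (hp : p ∈ u.source) :
    let X : Fin m → S → ℝ := fun i q => x q i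
    gaussCurvature ν x u p =
        -(Ω.rho u p ^ 4 / (8 * gdet ν x u p ^ 2 * (m - 3)!)) *
          ∑ L : Fin (m - 3) → Fin m, ∑ i, ∑ j, ∑ k, ∑ l, ∑ r, ∑ n,
            gbar ν i * gbar ν r * gbar ν n * eps j k l L * eps i r n L *
              Ω.bracket (X i) (Ω.bracket (X k) (X l)) p *
              Ω.bracket (X j) (Ω.bracket (X r) (X n)) p ∧
      ∀ k' : Fin m, meanCurvature ν x u p k' =
        Ω.rho u p ^ 4 / (8 * gdet ν x u p ^ 2 * (m - 3)!) *
          ∑ L : Fin (m - 3) → Fin m, ∑ i, ∑ j, ∑ k, ∑ l, ∑ r, ∑ n,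
            gbar ν j * gbar ν k * gbar ν l * eps i r n L * eps k' k l L *
              Ω.bracket (X i) (X j) p *
              Ω.bracket (X j) (Ω.bracket (X r) (X n)) p *
              Ω.bracket (X k) (X l) p := by
  intro X
  have hX : SmoothVecIn u x := smoothIn_comp_apply hu hx.contMDiff
  have h0 : ∀ q ∈ u.source, gdet ν x u q ≠ 0 := fun q hq => gdet_ne_zero hu hx.contMDiff hg hq
  have hgp := h0 p hp
  have hρ := Ω.rho_ne_zero hu hp
  have hfac : ((m - 3)! : ℝ) ≠ 0 := by positivity
  obtain ⟨σ, hσ⟩ := bracket_coord_bracket_coord Ω hu hX hp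
  have hgauss := gdet_mul_gaussCurvature hX h0 hp
  simp only [christoffel_eq hX hp, metric_inv, Fin.sum_univ_two] at hgauss
  have hsymm := hess_comm hX hp 1 0
  have hm00 : metric ν x u p 0 0 = scal ν (frame x u 0 p) (frame x u 0 p) := rfl
  have hm01 : metric ν x u p 0 1 = scal ν (frame x u 0 p) (frame x u 1 p) := rfl
  have hm11 : metric ν x u p 1 1 = scal ν (frame x u 1 p) (frame x u 1 p) := rfl
  have hdet := gdet_eq (ν := ν) (x := x) (u := u) (p := p)
  have hB := bracket_coord Ω hu hX hp
  set e₁ := frame x u 0 p with he₁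
  set e₂ := frame x u 1 p with he₂
  set ρ := Ω.rho u p
  set g := gdet ν x u p with hgdet
  refine ⟨?_, fun k' => ?_⟩
  · -- In both parts the factor `4` comes from the two bivectors, each summed over both orders of its
    -- indices.
    have hK : gaussCurvature ν x u p = g⁻¹ * (g * gaussCurvature ν x u p) := by
      field_simp
    have hL : ∀ L : Fin (m - 3) → Fin m, (∑ i, ∑ j, ∑ k, ∑ l, ∑ r, ∑ n,
        gbar ν i * gbar ν r * gbar ν n * eps j k l L * eps i r n L *
          Ω.bracket (X i) (Ω.bracket (X k) (X l)) p * Ω.bracket (X j) (Ω.bracket (X r) (X n)) p)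
        = 4 * ρ⁻¹ ^ 4 * (2 * (dualTriple L e₁ e₂ (hess x u 0 1 p) *
              dualTriple L (lower ν e₁) (lower ν e₂) (lower ν (hess x u 0 1 p)))
          - dualTriple L e₁ e₂ (hess x u 1 1 p) *
              dualTriple L (lower ν e₁) (lower ν e₂) (lower ν (hess x u 0 0 p))
          - dualTriple L e₁ e₂ (hess x u 0 0 p) *
              dualTriple L (lower ν e₁) (lower ν e₂) (lower ν (hess x u 1 1 p))) := by
      intro L
      simp only [X, hσ, sum_curvature_factor, ← bivectorDeriv_lower,
        dualWedge_fst_bivectorDeriv _ _ _ _ _ _ _ hm,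
        dualWedge_snd_bivectorDeriv _ _ _ _ _ _ _ hm, hsymm]
      ring
    simp only [hL, ← Finset.mul_sum, Finset.sum_sub_distrib, sum_dualTriple_mul_lower ν _ _ hm]
    rw [hK, hgauss]
    simp only [hm00, hm01, hm11, Matrix.smul_apply, Matrix.of_apply, Matrix.cons_val_zero,
      Matrix.cons_val_one, Matrix.cons_val', smul_eq_mul, scal_comm ν (hess x u 1 1 p)
        (hess x u 0 0 p)] at hdet ⊢
    rw [← hdet]
    field_simp
    ring
  · have hL : ∀ L : Fin (m - 3) → Fin m, (∑ i, ∑ j, ∑ k, ∑ l, ∑ r, ∑ n,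
        gbar ν j * gbar ν k * gbar ν l * eps i r n L * eps k' k l L *
          Ω.bracket (X i) (X j) p * Ω.bracket (X j) (Ω.bracket (X r) (X n)) p *
          Ω.bracket (X k) (X l) p)
        = 4 * ρ⁻¹ ^ 4 * (scal ν e₂ e₂ * (dualTriple L e₁ e₂ (hess x u 0 0 p) *
              dualTriple L (lower ν e₁) (lower ν e₂) (Pi.single k' 1))
          - 2 * scal ν e₁ e₂ * (dualTriple L e₁ e₂ (hess x u 0 1 p) *
              dualTriple L (lower ν e₁) (lower ν e₂) (Pi.single k' 1))
          + scal ν e₁ e₁ * (dualTriple L e₁ e₂ (hess x u 1 1 p) *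
              dualTriple L (lower ν e₁) (lower ν e₂) (Pi.single k' 1))) := by
      intro L
      simp only [X, hσ, hB, sum_meanCurvature_factor ν _ _ _ _ _ _ hm,
        dualWedge_fst_bivectorDeriv _ _ _ _ _ _ _ hm,
        dualWedge_snd_bivectorDeriv _ _ _ _ _ _ _ hm, hsymm]
      ring
    have hII : ∀ a b, shape ν x u a b p = hess x u a b p - tanProj ν x u p (hess x u a b p) :=
      fun _ _ => rfl
    simp only [hL, ← Finset.mul_sum, Finset.sum_sub_distrib, Finset.sum_add_distrib,
      sum_dualTriple_mul_single ν _ _ hm, meanCurvature, hII, tanProj, metric_inv,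
      Fin.sum_univ_two, Pi.smul_apply, Pi.add_apply, Pi.sub_apply, smul_eq_mul]
    simp only [← he₁, ← he₂, ← hgdet, hm00, hm01, hm11, Matrix.smul_apply,
      Matrix.of_apply, Matrix.cons_val_zero, Matrix.cons_val_one, Matrix.cons_val', smul_eq_mul,
      hsymm] at hdet ⊢
    rw [← hdet]
    field_simp
    ring
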